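/- Let $\mathcal A$ be a unital $C^*$-algebra and let $H_{\mathcal A}=\ell^2(\mathcal A)$ be the standard Hilbert module over $\mathcal A$, i.e. the (left) $\mathcal A$-module of all sequences $x=(x_k)_{k\in\mathbb N}$ in $\mathcal A$ such that $\sum_k x_kx_k^*$ converges in norm, with $\langle x,y\rangle=\sum_k y_kx_k^*$ and $\|x\|=\|\langle x,x\rangle\|^{1/2}$. Let $B^a(H_{\mathcal A})$ be the set of bounded $\mathcal A$-linear operators $F:H_{\mathcal A}\to H_{\mathcal A}$ that are adjointable, i.e. for which there is a bounded $\mathcal A$-linear $F^*$ with $\langle Fx,y\rangle=\langle x,F^*y\rangle$ for all $x,y$. For $F\in B^a(H_{\mathcal A})$ consider closed submodules $M_1,N_1,M_2,N_2$ of $H_{\mathcal A}$ such that $$H_{\mathcal A}=M_1\,\tilde\oplus\,N_1,\qquad H_{\mathcal A}=M_2\,\tilde\oplus\,N_2$$ (direct sums, not necessarily orthogonal) and such that, with respect to these decompositions of the domain and of the range, $F$ has the matrix $$\begin{pmatrix}F_1&0\\0&F_4\end{pmatrix},$$ where $F_1:M_1\to M_2$ is an isomorphism (bounded, $\mathcal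 A$-linear, with bounded inverse). Then $F$ is called * $\mathcal A$-Fredholm, $F\in\mathcal M\Phi(H_{\mathcal A})$, if there are such $M_1,N_1,M_2,N_2$ with both $N_1$ and $N_2$ finitely generated; * upper semi-$\mathcal A$-Fredholm, $F\in\mathcal M\Phi_+(H_{\mathcal A})$, if there are such $M_1,N_1,M_2,N_2$ with $N_1$ finitely generated; * lower semi-$\mathcal A$-Fredholm, $F\in\mathcal M\Phi_-(H_{\mathcal A})$, if there are such $M_1,N_1,M_2,N_2$ with $N_2$ finitely generated. Here a submodule is finitely generated if it is the $\mathcal A$-linear span of a finite subset. Then $$\mathcal M\Phi(H_{\mathcal A})=\mathcal M\Phi_+(H_{\mathcal A})\cap\mathcal M\Phi_-(H_{\mathcal A}).$$ -/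

import Mathlib

open scoped InnerProductSpace

noncomputable section

namespace HilbertCStar

/-- Cauchy-Schwarz inequality for finite sums in a C⋆-algebra. -/
theorem norm_finset_sum_mul_star_le {A : Type*} [CStarAlgebra A] (t : Finset ℕ) (x y : ℕ → A) :
    ‖∑ k ∈ t, y k * star (x k)‖ ≤
      √‖∑ k ∈ t, x k * star (x k)‖ * √‖∑ k ∈ t, y k * star (y k)‖ := by
  let _ : PartialOrder A := CStarAlgebra.spectralOrder A
  have _ : StarOrderedRing A := CStarAlgebra.spectralOrderedRing A
  have h := CStarModule.norm_inner_le (A := A) (WithCStarModule A (t → A))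
    (x := (WithCStarModule.equiv A (t → A)).symm fun k => x k)
    (y := (WithCStarModule.equiv A (t → A)).symm fun k => y k)
  simp only [WithCStarModule.pi_norm, WithCStarModule.pi_inner, WithCStarModule.inner_def,
    WithCStarModule.equiv_symm_pi_apply] at h
  rw [Finset.sum_coe_sort t (fun k => y k * star (x k)),
    Finset.sum_coe_sort t (fun k => x k * star (x k)),
    Finset.sum_coe_sort t (fun k => y k * star (y k))] at h
  exact h

/-- If `∑ xₖ xₖ⋆` and `∑ yₖ yₖ⋆` converge in norm, then so does `∑ yₖ xₖ⋆`. -/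
theorem summable_mul_star {A : Type*} [CStarAlgebra A] {x y : ℕ → A}
    (hx : Summable fun k => x k * star (x k)) (hy : Summable fun k => y k * star (y k)) :
    Summable fun k => y k * star (x k) := by
  rw [summable_iff_vanishing_norm] at hx hy ⊢
  intro ε hε
  obtain ⟨s, hs⟩ := hx ε hε
  obtain ⟨u, hu⟩ := hy ε hε
  refine ⟨s ∪ u, fun t ht => ?_⟩
  rw [Finset.disjoint_union_right] at ht
  refine (norm_finset_sum_mul_star_le t x y).trans_lt ?_
  have h1 := Real.sqrt_lt_sqrt (norm_nonneg _) (hs t ht.1)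
  have h2 := Real.sqrt_lt_sqrt (norm_nonneg _) (hu t ht.2)
  calc _ < √ε * √ε := mul_lt_mul'' h1 h2 (Real.sqrt_nonneg _) (Real.sqrt_nonneg _)
    _ = ε := Real.mul_self_sqrt hε.le

/-- The sequences `(xₖ)` in `A` for which `∑ xₖ xₖ⋆` converges in norm, as a left `A`-submodule of
the module of all sequences. (The terms are positive, so that norm convergence of the series and
unconditional summability are the same thing.) -/
def squareSummable (A : Type*) [CStarAlgebra A] : Submodule A (ℕ → A) where
  carrier := {x | Summable fun k => x k * star (x k)}
  zero_mem' := by simp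
  add_mem' {x y} hx hy := by
    have hx' : Summable fun k => x k * star (x k) := hx
    have hy' : Summable fun k => y k * star (y k) := hy
    have h := ((hx'.add hy').add (summable_mul_star hx' hy')).add (summable_mul_star hy' hx')
    refine h.congr fun k => ?_
    simp only [Pi.add_apply, star_add]
    noncomm_ring
  smul_mem' a x hx := by
    have hx' : Summable fun k => x k * star (x k) := hx
    refine ((hx'.mul_left a).mul_right (star a)).congr fun k => ?_
    simp [mul_assoc]

/-- The standard Hilbert module `H_A = ℓ²(A)` over a unital C⋆-algebra `A`. Following Mathlib's
`CStarModule`, it is a left `A`-module, with inner product `A`-linear in the second variable.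
It is a type of its own because its norm does not induce the topology of pointwise convergence
of sequences. -/
def StandardModule (A : Type*) [CStarAlgebra A] : Type _ := ↥(squareSummable A)

namespace StandardModule

variable {A : Type*} [CStarAlgebra A]

instance : AddCommGroup (StandardModule A) := inferInstanceAs (AddCommGroup ↥(squareSummable A))

instance : Module A (StandardModule A) := inferInstanceAs (Module A ↥(squareSummable A))

instance : Module ℂ (StandardModule A) := inferInstanceAs (Module ℂ ↥(squareSummable A))

instance : IsScalarTower ℂ A (StandardModule A) :=
  inferInstanceAs (IsScalarTower ℂ A ↥(squareSummable A))

/-- The `A`-valued inner product `⟪x, y⟫ = ∑ yₖ xₖ⋆`. -/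
instance : Inner A (StandardModule A) where
  inner x y := ∑' k, y.1 k * star (x.1 k)

/-- The Hilbert module norm `‖x‖ = ‖⟪x, x⟫‖ ^ (1/2)`. -/
instance : Norm (StandardModule A) where
  norm x := √‖⟪x, x⟫_A‖

theorem inner_def (x y : StandardModule A) : ⟪x, y⟫_A = ∑' k, y.1 k * star (x.1 k) := rfl

theorem summable_inner (x y : StandardModule A) : Summable fun k => y.1 k * star (x.1 k) :=
  summable_mul_star x.2 y.2

instance [PartialOrder A] [StarOrderedRing A] : CStarModule A (StandardModule A) where
  inner_add_right {x y z} := by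
    simp only [inner_def]
    rw [← (summable_inner x y).tsum_add (summable_inner x z)]
    exact tsum_congr fun k => add_mul (y.1 k) (z.1 k) _
  inner_self_nonneg {x} := tsum_nonneg fun k => mul_star_self_nonneg (x.1 k)
  inner_self {x} := by
    constructor
    · intro h
      have h0 := (hasSum_zero_iff_of_nonneg fun k => mul_star_self_nonneg (x.1 k)).1
        (h ▸ (summable_inner x x).hasSum :
          HasSum (fun k => x.1 k * star (x.1 k)) 0)
      refine Subtype.ext (funext fun k => ?_)
      exact (CStarRing.mul_star_self_eq_zero_iff (x.1 k)).1 (congrFun h0 k)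
    · rintro rfl
      exact (tsum_congr fun k => zero_mul (star ((0 : StandardModule A).1 k))).trans tsum_zero
  inner_op_smul_right {a x y} := by
    simp only [inner_def]
    rw [← (summable_inner x y).tsum_mul_left]
    exact tsum_congr fun k => mul_assoc a (y.1 k) _
  inner_smul_right_complex {z x y} := by
    simp only [inner_def]
    rw [← (summable_inner x y).tsum_const_smul]
    exact tsum_congr fun k => smul_mul_assoc z (y.1 k) _
  star_inner x y := by
    simp only [inner_def]
    rw [tsum_star]
    simp only [star_mul, star_star]
  norm_eq_sqrt_norm_inner_self x := rfl

theorem normedSpaceCore : NormedSpace.Core ℂ (StandardModule A) := by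
  let _ : PartialOrder A := CStarAlgebra.spectralOrder A
  have _ : StarOrderedRing A := CStarAlgebra.spectralOrderedRing A
  exact CStarModule.normedSpaceCore A

instance : NormedAddCommGroup (StandardModule A) := NormedAddCommGroup.ofCore normedSpaceCore

instance : NormedSpace ℂ (StandardModule A) := NormedSpace.ofCore normedSpaceCore

end StandardModule

section Fredholm

variable {A : Type*} [CStarAlgebra A]

/-- A bounded `A`-linear operator on `H_A` is adjointable if it has an adjoint with respect to the
`A`-valued inner product. -/
def IsAdjointable (F : StandardModule A →L[A] StandardModule A) : Prop :=
  ∃ G : StandardModule A →L[A] StandardModule A, ∀ x y, ⟪F x, y⟫_A = ⟪x, G y⟫_A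

variable (A) in
/-- The set `B^a(H_A)` of bounded adjointable operators on `H_A`. -/
def adjointableOperators : Set (StandardModule A →L[A] StandardModule A) :=
  {F | IsAdjointable F}

/-- `F` has a diagonal matrix `[F₁, 0; 0, F₄]` with respect to direct sum decompositions
`H_A = M₁ ⊕ N₁` of the domain and `H_A = M₂ ⊕ N₂` of the range into closed (not necessarily
orthogonal) submodules, and `F₁ : M₁ → M₂` is an isomorphism (bounded, `A`-linear, with bounded
inverse). -/
structure IsDiagonalDecomposition (F : StandardModule A →L[A] StandardModule A)
    (M₁ N₁ M₂ N₂ : Submodule A (StandardModule A)) : Prop where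
  isClosed_M₁ : IsClosed (M₁ : Set (StandardModule A))
  isClosed_N₁ : IsClosed (N₁ : Set (StandardModule A))
  isClosed_M₂ : IsClosed (M₂ : Set (StandardModule A))
  isClosed_N₂ : IsClosed (N₂ : Set (StandardModule A))
  isCompl_domain : IsCompl M₁ N₁
  isCompl_range : IsCompl M₂ N₂
  iso : ∃ F₁ : M₁ ≃L[A] M₂, ∀ x : M₁, F x = F₁ x
  map_N : ∀ x ∈ N₁, F x ∈ N₂

variable (A) in
/-- `MΦ(H_A)`: the `A`-Fredholm operators. -/
def fredholm : Set (StandardModule A →L[A] StandardModule A) :=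
  {F | F ∈ adjointableOperators A ∧
    ∃ M₁ N₁ M₂ N₂, IsDiagonalDecomposition F M₁ N₁ M₂ N₂ ∧ N₁.FG ∧ N₂.FG}

variable (A) in
/-- `MΦ₊(H_A)`: the upper semi-`A`-Fredholm operators. -/
def upperSemiFredholm : Set (StandardModule A →L[A] StandardModule A) :=
  {F | F ∈ adjointableOperators A ∧
    ∃ M₁ N₁ M₂ N₂, IsDiagonalDecomposition F M₁ N₁ M₂ N₂ ∧ N₁.FG}

variable (A) in
/-- `MΦ₋(H_A)`: the lower semi-`A`-Fredholm operators. -/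
def lowerSemiFredholm : Set (StandardModule A →L[A] StandardModule A) :=
  {F | F ∈ adjointableOperators A ∧
    ∃ M₁ N₁ M₂ N₂, IsDiagonalDecomposition F M₁ N₁ M₂ N₂ ∧ N₂.FG}

end Fredholm

end HilbertCStar

end

/-!
Only `upper ∩ lower ⊆ Fredholm` needs an argument. If `F` is upper semi-Fredholm, then
`‖y‖ ≤ C (‖F y‖ + ∑ i, ‖⟪y, u i⟫‖)` for finitely many vectors `u i`. For the right shift `S` by a
large number `n` of places, `‖⟪S x, u i⟫‖ ≤ ‖x‖ ‖S⋆ (u i)‖` is absorbed by the left-hand side, so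
that `F S` is bounded below. An adjointable operator `T` which is bounded below has an invertible
`T⋆ T`; for `T = F S` this makes `S⋆ F⋆` a left inverse of `F S`, up to an automorphism, and splits
`F` along `ran S ⊕ ker (S⋆ F⋆ F)` and `ran (F S) ⊕ ker (S⋆ F⋆)`. The range of `S` has a finitely
generated complement, and so does the range of `F S` as soon as the range of `F` has a finitely
generated supplement, which is what lower semi-Fredholmness provides.
-/

noncomputable section

open Filter Topology

namespace HilbertCStar

/-! ### Modules and Banach spaces -/

theorem cofg_range_comp {R M N P : Type*} [Ring R] [AddCommGroup M] [Module R M] [AddCommGroup N]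
    [Module R N] [AddCommGroup P] [Module R P] {f : N →ₗ[R] P} {g : M →ₗ[R] N}
    (hf : f.range.CoFG) (hg : g.range.CoFG) : (f ∘ₗ g).range.CoFG := by
  have hle : g.range ≤ (f ∘ₗ g).range.comap f := by
    rintro _ ⟨x, rfl⟩
    exact ⟨x, rfl⟩
  have hexact : Function.Exact (g.range.mapQ (f ∘ₗ g).range f hle)
      (Submodule.factor (LinearMap.range_comp_le_range g f)) := by
    rw [LinearMap.exact_iff, Submodule.factor, Submodule.ker_mapQ, Submodule.range_mapQ,
      Submodule.comap_id]
  exact .of_exact hexact (Submodule.factor_surjective _)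

theorem exists_leftInverse_of_bijective (𝕜 : Type*) {R E : Type*} [NontriviallyNormedField 𝕜]
    [Ring R] [NormedAddCommGroup E] [NormedSpace 𝕜 E] [CompleteSpace E] [Module R E] [SMul 𝕜 R]
    [IsScalarTower 𝕜 R E] {T : E →L[R] E} (hT : Function.Bijective T) :
    ∃ T' : E →L[R] E, Function.LeftInverse T' T := by
  let e : E ≃ₗ[R] E := LinearEquiv.ofBijective (T : E →ₗ[R] E) hT
  exact ⟨⟨e.symm, (e.restrictScalars 𝕜).continuous_symm T.continuous⟩, e.symm_apply_apply⟩

theorem exists_norm_le_of_isCompl (𝕜 : Type*) {R E : Type*} [NontriviallyNormedField 𝕜]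
    [Ring R] [NormedAddCommGroup E] [NormedSpace 𝕜 E] [CompleteSpace E] [Module R E] [SMul 𝕜 R]
    [IsScalarTower 𝕜 R E] {M N : Submodule R E} (h : IsCompl M N) (hM : IsClosed (M : Set E))
    (hN : IsClosed (N : Set E)) :
    ∃ C : ℝ, 0 ≤ C ∧ ∀ m ∈ M, ∀ n ∈ N, ‖m‖ ≤ C * ‖m + n‖ := by
  have hc : (M.restrictScalars 𝕜).IsTopCompl (N.restrictScalars 𝕜) :=
    Submodule.IsCompl.isTopCompl_of_isClosed ((Submodule.isCompl_restrictScalars_iff 𝕜).2 h) hM hN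
  let π := Submodule.projectionL _ _ hc
  refine ⟨‖π‖, norm_nonneg π, fun m hm n hn => ?_⟩
  have hπ : π (m + n) = m := by
    rw [map_add, Submodule.projectionL_apply_left hc ⟨m, hm⟩,
      (Submodule.projectionL_apply_eq_zero_iff hc).2 hn, add_zero]
  simpa only [hπ] using π.le_opNorm (m + n)

theorem exists_norm_coeff_le_of_isClosed_span (𝕜 : Type*) {A E ι : Type*}
    [NontriviallyNormedField 𝕜] [NormedRing A] [NormedAlgebra 𝕜 A] [CompleteSpace A]
    [NormedAddCommGroup E] [NormedSpace 𝕜 E] [CompleteSpace E] [Module A E] [IsScalarTower 𝕜 A E]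
    [IsBoundedSMul A E] [Fintype ι] (u : ι → E)
    (hu : IsClosed (Submodule.span A (Set.range u) : Set E)) :
    ∃ C > 0, ∀ x ∈ Submodule.span A (Set.range u),
      ∃ a : ι → A, ∑ i, a i • u i = x ∧ ‖a‖ ≤ C * ‖x‖ := by
  set N := (Submodule.span A (Set.range u)).restrictScalars 𝕜
  let φ : (ι → A) →L[𝕜] E :=
    ⟨(Fintype.linearCombination A u).restrictScalars 𝕜, by
      change Continuous fun a : ι → A => ∑ i, a i • u i
      fun_prop⟩
  have hrange : φ.range = N :=
    congrArg (Submodule.restrictScalars 𝕜) (Fintype.range_linearCombination A u)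
  let ψ : (ι → A) →L[𝕜] N := φ.codRestrict N fun a => hrange ▸ ⟨a, rfl⟩
  have hψ : Function.Surjective ψ := by
    rintro ⟨x, hx⟩
    obtain ⟨a, ha⟩ : x ∈ φ.range := hrange ▸ hx
    exact ⟨a, Subtype.ext ha⟩
  have : CompleteSpace N := hu.completeSpace_coe
  obtain ⟨C, hC, h⟩ := ψ.exists_preimage_norm_le hψ
  refine ⟨C, hC, fun x hx => ?_⟩
  obtain ⟨a, ha, hna⟩ := h ⟨x, hx⟩
  exact ⟨a, congrArg Subtype.val ha, hna⟩

section MethodOfContinuity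

variable {𝕜 E : Type*} [NormedAddCommGroup E] [CompleteSpace E]

theorem isUnit_of_norm_sub_lt [NontriviallyNormedField 𝕜] [NormedSpace 𝕜 E] {S T : E →L[𝕜] E}
    {c : ℝ} (hS : IsUnit S) (hbelow : ∀ x, c * ‖x‖ ≤ ‖S x‖) (hST : ‖T - S‖ < c) : IsUnit T := by
  rcases subsingleton_or_nontrivial E with hE | hE
  · exact isUnit_of_subsingleton T
  obtain ⟨u, rfl⟩ := hS
  have hc : 0 < c := (norm_nonneg _).trans_lt hST
  have hinv : ‖(↑u⁻¹ : E →L[𝕜] E)‖ ≤ c⁻¹ := by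
    refine ContinuousLinearMap.opNorm_le_bound _ (by positivity) fun y => ?_
    have huy : (u : E →L[𝕜] E) ((↑u⁻¹ : E →L[𝕜] E) y) = y := DFunLike.congr_fun u.mul_inv y
    rw [le_inv_mul_iff₀ hc]
    simpa only [huy] using hbelow ((↑u⁻¹ : E →L[𝕜] E) y)
  refine (u.ofNearby T (hST.trans_le ?_)).isUnit
  rwa [le_inv_comm₀ hc (Units.norm_pos _)]

theorem isUnit_add_smul_of_norm_lt [RCLike 𝕜] [NormedSpace 𝕜 E] (T : E →L[𝕜] E) {s : ℝ}
    (hs : ‖T‖ < s) : IsUnit (T + (s : 𝕜) • 1) := by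
  rcases subsingleton_or_nontrivial E with hE | hE
  · exact isUnit_of_subsingleton _
  have hmem : (s : 𝕜) ∈ resolventSet 𝕜 (-T) :=
    spectrum.mem_resolventSet_of_norm_lt <| by
      rwa [norm_neg, RCLike.norm_ofReal, abs_of_nonneg ((norm_nonneg T).trans hs.le)]
  rwa [spectrum.mem_resolventSet_iff, sub_neg_eq_add, Algebra.algebraMap_eq_smul_one,
    add_comm] at hmem

theorem isUnit_of_forall_le_norm_add_smul [RCLike 𝕜] [NormedSpace 𝕜 E] {T : E →L[𝕜] E} {c : ℝ}
    (hc : 0 < c) (hT : ∀ s : ℝ, 0 ≤ s → ∀ x, c * ‖x‖ ≤ ‖(T + (s : 𝕜) • 1) x‖) : IsUnit T := by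
  have step (s : ℝ) (hs : 0 ≤ s) (h : IsUnit (T + ((s + c / 2 : ℝ) : 𝕜) • 1)) :
      IsUnit (T + (s : 𝕜) • 1) := by
    refine isUnit_of_norm_sub_lt h (hT _ (by positivity)) ?_
    calc ‖T + (s : 𝕜) • 1 - (T + ((s + c / 2 : ℝ) : 𝕜) • 1)‖
        = ‖((c / 2 : ℝ) : 𝕜) • (1 : E →L[𝕜] E)‖ := by
          rw [add_sub_add_left_eq_sub, ← sub_smul, ← RCLike.ofReal_sub, sub_add_cancel_left,
            RCLike.ofReal_neg, neg_smul, norm_neg]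
      _ ≤ c / 2 * 1 := by
          rw [norm_smul, RCLike.norm_ofReal, abs_of_pos (by positivity)]
          gcongr
          exact ContinuousLinearMap.norm_id_le
      _ < c := by linarith
  have descend (k : ℕ) : IsUnit (T + ((k * (c / 2) : ℝ) : 𝕜) • 1) → IsUnit T := by
    induction k with
    | zero => simp
    | succ k ih =>
      intro h
      refine ih (step _ (by positivity) ?_)
      rwa [Nat.cast_succ, add_one_mul] at h
  obtain ⟨k, hk⟩ := exists_nat_gt (‖T‖ / (c / 2))
  exact descend k (isUnit_add_smul_of_norm_lt T ((div_lt_iff₀ (by positivity)).1 hk))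

end MethodOfContinuity

/-! ### Hilbert C⋆-modules -/

section HilbertModule

variable {A E E' : Type*} [CStarAlgebra A] [PartialOrder A]
  [NormedAddCommGroup E] [NormedSpace ℂ E] [Module A E] [CStarModule A E]
  [NormedAddCommGroup E'] [NormedSpace ℂ E'] [Module A E'] [CStarModule A E']

variable (A E) in
theorem isBoundedSMul_of_cStarModule : IsBoundedSMul A E := by
  refine .of_norm_smul_le fun a x => le_of_sq_le_sq ?_ (by positivity)
  calc ‖a • x‖ ^ 2 = ‖a * ⟪x, x⟫_A * star a‖ := by
        rw [CStarModule.norm_sq_eq A, CStarModule.inner_op_smul_right,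
          CStarModule.inner_op_smul_left, mul_assoc]
    _ ≤ ‖a‖ * ‖⟪x, x⟫_A‖ * ‖star a‖ := norm_mul₃_le
    _ = (‖a‖ * ‖x‖) ^ 2 := by rw [norm_star, ← CStarModule.norm_sq_eq A]; ring

theorem exists_norm_le_sum_norm_inner [CompleteSpace E] [IsScalarTower ℂ A E] {ι : Type*}
    [Fintype ι] (u : ι → E) (hu : IsClosed (Submodule.span A (Set.range u) : Set E)) :
    ∃ C > 0, ∀ x ∈ Submodule.span A (Set.range u), ‖x‖ ≤ C * ∑ i, ‖⟪x, u i⟫_A‖ := by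
  have : IsBoundedSMul A E := isBoundedSMul_of_cStarModule A E
  obtain ⟨C, hC, hcoeff⟩ := exists_norm_coeff_le_of_isClosed_span ℂ u hu
  refine ⟨C, hC, fun x hx => ?_⟩
  obtain ⟨a, hax, ha⟩ := hcoeff x hx
  rcases (norm_nonneg x).eq_or_lt with h0 | hpos
  · rw [← h0]; positivity
  refine le_of_mul_le_mul_left ?_ hpos
  have hinner : ⟪x, x⟫_A = ∑ i, a i * ⟪x, u i⟫_A := by
    conv_lhs => rw [← hax, CStarModule.inner_sum_right, hax]
    simp only [CStarModule.inner_op_smul_right]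
  calc ‖x‖ * ‖x‖ = ‖∑ i, a i * ⟪x, u i⟫_A‖ := by rw [← hinner, ← CStarModule.norm_sq_eq A, sq]
    _ ≤ ∑ i, ‖a i‖ * ‖⟪x, u i⟫_A‖ := norm_sum_le_of_le _ fun i _ => norm_mul_le _ _
    _ ≤ ∑ i, C * ‖x‖ * ‖⟪x, u i⟫_A‖ := by gcongr with i; exact (norm_le_pi_norm a i).trans ha
    _ = ‖x‖ * (C * ∑ i, ‖⟪x, u i⟫_A‖) := by rw [← Finset.mul_sum]; ring

variable [StarOrderedRing A]

theorem exists_norm_add_le_norm_add_sum_norm_inner [CompleteSpace E] [IsScalarTower ℂ A E]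
    {ι : Type*} [Fintype ι] (u : ι → E) (hu : IsClosed (Submodule.span A (Set.range u) : Set E)) :
    ∃ C > 0, ∀ p, ∀ q ∈ Submodule.span A (Set.range u),
      ‖p + q‖ ≤ C * (‖p‖ + ∑ i, ‖⟪p + q, u i⟫_A‖) := by
  obtain ⟨C, hC, hN⟩ := exists_norm_le_sum_norm_inner u hu
  refine ⟨1 + C * ∑ i, ‖u i‖ + C, by positivity, fun p q hq => ?_⟩
  have hinner (i : ι) : ‖⟪q, u i⟫_A‖ ≤ ‖⟪p + q, u i⟫_A‖ + ‖p‖ * ‖u i‖ := by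
    calc ‖⟪q, u i⟫_A‖ = ‖⟪p + q, u i⟫_A - ⟪p, u i⟫_A‖ := by
          rw [CStarModule.inner_add_left, add_sub_cancel_left]
      _ ≤ ‖⟪p + q, u i⟫_A‖ + ‖⟪p, u i⟫_A‖ := norm_sub_le _ _
      _ ≤ ‖⟪p + q, u i⟫_A‖ + ‖p‖ * ‖u i‖ := by gcongr; exact CStarModule.norm_inner_le E
  calc ‖p + q‖ ≤ ‖p‖ + C * ∑ i, ‖⟪q, u i⟫_A‖ := norm_add_le_of_le le_rfl (hN q hq)
    _ ≤ ‖p‖ + C * ∑ i, (‖⟪p + q, u i⟫_A‖ + ‖p‖ * ‖u i‖) := by gcongr with i; exact hinner i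
    _ = (1 + C * ∑ i, ‖u i‖) * ‖p‖ + C * ∑ i, ‖⟪p + q, u i⟫_A‖ := by
        rw [Finset.sum_add_distrib, ← Finset.mul_sum]; ring
    _ ≤ (1 + C * ∑ i, ‖u i‖ + C) * (‖p‖ + ∑ i, ‖⟪p + q, u i⟫_A‖) := by
        have : 0 ≤ (1 + C * ∑ i, ‖u i‖) * ∑ i, ‖⟪p + q, u i⟫_A‖ + C * ‖p‖ := by positivity
        linarith

theorem norm_adjoint_le {S : E → E'} {B : E' → E} (hSB : ∀ x y, ⟪S x, y⟫_A = ⟪x, B y⟫_A) {C : ℝ}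
    (hC : 0 ≤ C) (hS : ∀ x, ‖S x‖ ≤ C * ‖x‖) (y : E') : ‖B y‖ ≤ C * ‖y‖ := by
  rcases (norm_nonneg (B y)).eq_or_lt with h0 | hpos
  · rw [← h0]; positivity
  refine le_of_mul_le_mul_left ?_ hpos
  calc ‖B y‖ * ‖B y‖ = ‖⟪S (B y), y⟫_A‖ := by rw [hSB, ← CStarModule.norm_sq_eq A, sq]
    _ ≤ ‖S (B y)‖ * ‖y‖ := CStarModule.norm_inner_le E'
    _ ≤ C * ‖B y‖ * ‖y‖ := by gcongr; exact hS _
    _ = ‖B y‖ * (C * ‖y‖) := by ring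

theorem le_norm_adjoint_comp_add_smul {F : E →L[ℂ] E'} {G : E' →L[ℂ] E}
    (hFG : ∀ x y, ⟪F x, y⟫_A = ⟪x, G y⟫_A) {c : ℝ} (hc : 0 ≤ c) (hF : ∀ x, c * ‖x‖ ≤ ‖F x‖) {s : ℝ}
    (hs : 0 ≤ s) (x : E) : c ^ 2 * ‖x‖ ≤ ‖(G ∘L F + (s : ℂ) • 1) x‖ := by
  set z := (G ∘L F + (s : ℂ) • 1) x with hz
  have hinner : ⟪x, z⟫_A = ⟪F x, F x⟫_A + s • ⟪x, x⟫_A := by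
    simp [hz, CStarModule.inner_add_right, hFG]
  have hle : ⟪F x, F x⟫_A ≤ ⟪x, z⟫_A :=
    hinner ▸ le_add_of_nonneg_right (smul_nonneg hs CStarModule.inner_self_nonneg)
  rcases (norm_nonneg x).eq_or_lt with h0 | hpos
  · rw [← h0, mul_zero]; exact norm_nonneg z
  refine le_of_mul_le_mul_left ?_ hpos
  calc ‖x‖ * (c ^ 2 * ‖x‖) = (c * ‖x‖) ^ 2 := by ring
    _ ≤ ‖F x‖ ^ 2 := by gcongr; exact hF x
    _ = ‖⟪F x, F x⟫_A‖ := CStarModule.norm_sq_eq A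
    _ ≤ ‖⟪x, z⟫_A‖ := CStarAlgebra.norm_le_norm_of_nonneg_of_le CStarModule.inner_self_nonneg hle
    _ ≤ ‖x‖ * ‖z‖ := CStarModule.norm_inner_le E

theorem isUnit_adjoint_comp [CompleteSpace E] {F : E →L[ℂ] E'} {G : E' →L[ℂ] E}
    (hFG : ∀ x y, ⟪F x, y⟫_A = ⟪x, G y⟫_A) {c : ℝ} (hc : 0 < c) (hF : ∀ x, c * ‖x‖ ≤ ‖F x‖) :
    IsUnit (G ∘L F) :=
  isUnit_of_forall_le_norm_add_smul (pow_pos hc 2) fun _ hs x =>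
    le_norm_adjoint_comp_add_smul hFG hc.le hF hs x

theorem exists_leftInverse_of_adjoint [CompleteSpace E] [IsScalarTower ℂ A E]
    [IsScalarTower ℂ A E'] {T : E →L[A] E'} {G : E' →L[A] E} (hTG : ∀ x y, ⟪T x, y⟫_A = ⟪x, G y⟫_A)
    {c : ℝ} (hc : 0 < c) (hT : ∀ x, c * ‖x‖ ≤ ‖T x‖) :
    ∃ L : E' →L[A] E, Function.LeftInverse L T := by
  have hunit : IsUnit (G.restrictScalars ℂ ∘L T.restrictScalars ℂ) :=
    isUnit_adjoint_comp (A := A) hTG hc hT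
  obtain ⟨R, hR⟩ := exists_leftInverse_of_bijective ℂ (T := G ∘L T)
    (ContinuousLinearMap.isUnit_iff_bijective.1 hunit)
  exact ⟨R ∘L G, hR⟩

end HilbertModule

namespace StandardModule

/-! ### Completeness of the standard module -/

section Complete

variable {A : Type*} [CStarAlgebra A]

/-- The Hilbert module norm `‖∑ k ∈ t, xₖ xₖ⋆‖ ^ (1/2)` of the truncation to `t` of an arbitrary
sequence `x`. It serves to decide square-summability of sequences and to compute their norm. -/
def truncNorm (t : Finset ℕ) (x : ℕ → A) : ℝ := √‖∑ k ∈ t, x k * star (x k)‖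

theorem truncNorm_add_le (t : Finset ℕ) (x y : ℕ → A) :
    truncNorm t (x + y) ≤ truncNorm t x + truncNorm t y := by
  let _ : PartialOrder A := CStarAlgebra.spectralOrder A
  have _ : StarOrderedRing A := CStarAlgebra.spectralOrderedRing A
  have norm_restrict (z : ℕ → A) :
      truncNorm t z = ‖(WithCStarModule.equiv A (t → A)).symm fun k => z k‖ := by
    simp only [truncNorm, WithCStarModule.pi_norm, WithCStarModule.inner_def,
      WithCStarModule.equiv_symm_pi_apply]
    rw [Finset.sum_coe_sort t fun k => z k * star (z k)]
  rw [norm_restrict, norm_restrict, norm_restrict]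
  exact norm_add_le ((WithCStarModule.equiv A (t → A)).symm fun k => x k) _

theorem mem_squareSummable_iff {x : ℕ → A} :
    x ∈ squareSummable A ↔ ∀ ε > 0, ∃ s, ∀ t, Disjoint t s → truncNorm t x < ε := by
  refine summable_iff_vanishing_norm.trans ⟨fun h ε hε => ?_, fun h ε hε => ?_⟩
  · obtain ⟨s, hs⟩ := h (ε ^ 2) (by positivity)
    exact ⟨s, fun t ht => (Real.sqrt_lt' hε).2 (hs t ht)⟩
  · obtain ⟨s, hs⟩ := h (√ε) (by positivity)
    exact ⟨s, fun t ht => (Real.sqrt_lt_sqrt_iff (norm_nonneg _)).1 (hs t ht)⟩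

theorem mem_squareSummable_of_forall_truncNorm_sub_le {x : ℕ → A}
    (h : ∀ ε > 0, ∃ u ∈ squareSummable A, ∀ t, truncNorm t (x - u) ≤ ε) :
    x ∈ squareSummable A := by
  refine mem_squareSummable_iff.2 fun ε hε => ?_
  obtain ⟨u, hu, hxu⟩ := h (ε / 2) (by positivity)
  obtain ⟨s, hs⟩ := mem_squareSummable_iff.1 hu (ε / 2) (by positivity)
  refine ⟨s, fun t ht => ?_⟩
  calc truncNorm t x = truncNorm t (x - u + u) := by rw [sub_add_cancel]
    _ ≤ truncNorm t (x - u) + truncNorm t u := truncNorm_add_le t _ _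
    _ < ε / 2 + ε / 2 := add_lt_add_of_le_of_lt (hxu t) (hs t ht)
    _ = ε := add_halves ε

theorem truncNorm_le_norm (t : Finset ℕ) (x : StandardModule A) : truncNorm t x.1 ≤ ‖x‖ := by
  let _ : PartialOrder A := CStarAlgebra.spectralOrder A
  have _ : StarOrderedRing A := CStarAlgebra.spectralOrderedRing A
  exact Real.sqrt_le_sqrt <| CStarAlgebra.norm_le_norm_of_nonneg_of_le
    (Finset.sum_nonneg fun k _ => mul_star_self_nonneg (x.1 k))
    ((summable_inner x x).sum_le_tsum t fun k _ => mul_star_self_nonneg (x.1 k))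

theorem norm_apply_le (x : StandardModule A) (k : ℕ) : ‖x.1 k‖ ≤ ‖x‖ := by
  have h := truncNorm_le_norm {k} x
  rwa [truncNorm, Finset.sum_singleton, CStarRing.norm_self_mul_star,
    Real.sqrt_mul_self (norm_nonneg _)] at h

theorem lipschitzWith_apply (k : ℕ) : LipschitzWith 1 fun x : StandardModule A => x.1 k :=
  .mk_one fun x y => by rw [dist_eq_norm, dist_eq_norm]; exact norm_apply_le (x - y) k

theorem norm_le_of_forall_truncNorm_le {x : StandardModule A} {r : ℝ}
    (h : ∀ t, truncNorm t x.1 ≤ r) : ‖x‖ ≤ r :=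
  le_of_tendsto' (summable_inner x x).hasSum.norm.sqrt h

instance : CompleteSpace (StandardModule A) := by
  refine Metric.complete_of_cauchySeq_tendsto fun u hu => ?_
  have hcoord (k : ℕ) : CauchySeq fun j => (u j).1 k :=
    hu.map (lipschitzWith_apply k).uniformContinuous
  choose x hx using fun k => cauchySeq_tendsto_of_complete (hcoord k)
  have hbound (ε : ℝ) (hε : 0 < ε) : ∃ N, ∀ n ≥ N, ∀ t, truncNorm t (x - (u n).1) ≤ ε := by
    obtain ⟨N, hN⟩ := Metric.cauchySeq_iff.1 hu ε hε
    refine ⟨N, fun n hn t => ?_⟩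
    have hlim : Tendsto (fun j => truncNorm t (u j - u n).1) atTop
        (𝓝 (truncNorm t (x - (u n).1))) :=
      (tendsto_finsetSum t fun k _ =>
        ((hx k).sub_const _).mul ((hx k).sub_const _).star).norm.sqrt
    refine le_of_tendsto hlim (eventually_atTop.2 ⟨N, fun j hj => ?_⟩)
    exact (truncNorm_le_norm t _).trans (dist_eq_norm (u j) (u n) ▸ (hN j hj n hn).le)
  have hmem : x ∈ squareSummable A :=
    mem_squareSummable_of_forall_truncNorm_sub_le fun ε hε =>
      let ⟨N, hN⟩ := hbound ε hε
      ⟨(u N).1, (u N).2, hN N le_rfl⟩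
  let y : StandardModule A := ⟨x, hmem⟩
  refine ⟨y, Metric.tendsto_atTop'.2 fun ε hε => ?_⟩
  obtain ⟨N, hN⟩ := hbound (ε / 2) (by positivity)
  refine ⟨N, fun n hn => ?_⟩
  rw [dist_comm, dist_eq_norm]
  exact (norm_le_of_forall_truncNorm_le (x := y - u n) (hN n hn.le)).trans_lt (half_lt_self hε)

instance : IsBoundedSMul A (StandardModule A) := by
  let _ : PartialOrder A := CStarAlgebra.spectralOrder A
  have _ : StarOrderedRing A := CStarAlgebra.spectralOrderedRing A
  exact isBoundedSMul_of_cStarModule A (StandardModule A)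

end Complete

/-! ### Shifts -/

section Shift

variable {A : Type*} [CStarAlgebra A] (n : ℕ)

@[ext]
protected theorem ext {x y : StandardModule A} (h : ∀ k, x.1 k = y.1 k) : x = y :=
  Subtype.ext (funext h)

@[simp] theorem add_apply (x y : StandardModule A) (k : ℕ) : (x + y).1 k = x.1 k + y.1 k := rfl

@[simp] theorem smul_apply (a : A) (x : StandardModule A) (k : ℕ) : (a • x).1 k = a * x.1 k := rfl

/-- The right shift by `n` places, which fills up with zeros. -/
def shift : StandardModule A →ₗ[A] StandardModule A :=
  LinearMap.codRestrict (squareSummable A)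
    { toFun x k := if k < n then 0 else x.1 (k - n)
      map_add' x y := by ext k; by_cases hk : k < n <;> simp [hk]
      map_smul' a x := by ext k; by_cases hk : k < n <;> simp [hk] }
    fun x => (summable_nat_add_iff n).1 (by simpa using summable_inner x x)

/-- The left shift by `n` places, the adjoint of `shift n`. -/
def backwardShift : StandardModule A →ₗ[A] StandardModule A :=
  LinearMap.codRestrict (squareSummable A)
    { toFun x k := x.1 (k + n)
      map_add' _ _ := rfl
      map_smul' _ _ := rfl }
    fun x => (summable_nat_add_iff n).2 (summable_inner x x)

theorem shift_apply (x : StandardModule A) (k : ℕ) :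
    (shift n x).1 k = if k < n then 0 else x.1 (k - n) := rfl

theorem backwardShift_apply (x : StandardModule A) (k : ℕ) :
    (backwardShift n x).1 k = x.1 (k + n) := rfl

theorem backwardShift_shift (x : StandardModule A) : backwardShift n (shift n x) = x := by
  ext k
  simp [shift_apply, backwardShift_apply]

theorem inner_shift_left (x y : StandardModule A) :
    ⟪shift n x, y⟫_A = ⟪x, backwardShift n y⟫_A := by
  have hzero : ∑ k ∈ Finset.range n, y.1 k * star ((shift n x).1 k) = 0 :=
    Finset.sum_eq_zero fun k hk => by simp [shift_apply, Finset.mem_range.1 hk]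
  rw [inner_def, ← (summable_inner (shift n x) y).sum_add_tsum_nat_add n, hzero, zero_add]
  simp [inner_def, shift_apply, backwardShift_apply]

theorem norm_shift (x : StandardModule A) : ‖shift n x‖ = ‖x‖ :=
  congrArg (fun a : A => √‖a‖) ((inner_shift_left n x _).trans (by rw [backwardShift_shift]))

theorem norm_backwardShift_le (x : StandardModule A) : ‖backwardShift n x‖ ≤ ‖x‖ := by
  let _ : PartialOrder A := CStarAlgebra.spectralOrder A
  have _ : StarOrderedRing A := CStarAlgebra.spectralOrderedRing A
  simpa using norm_adjoint_le (inner_shift_left n) zero_le_one (fun y => by simp [norm_shift]) x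

theorem tendsto_norm_backwardShift (x : StandardModule A) :
    Tendsto (fun n => ‖backwardShift n x‖) atTop (𝓝 0) := by
  have h := (tendsto_sum_nat_add fun k => x.1 k * star (x.1 k)).norm.sqrt
  rwa [norm_zero, Real.sqrt_zero] at h

/-- `shift n` as a bounded operator. -/
def shiftL : StandardModule A →L[A] StandardModule A :=
  (shift n).mkContinuous 1 fun x => by rw [norm_shift, one_mul]

/-- `backwardShift n` as a bounded operator. -/
def backwardShiftL : StandardModule A →L[A] StandardModule A :=
  (backwardShift n).mkContinuous 1 fun x => by rw [one_mul]; exact norm_backwardShift_le n x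

/-- The inclusion of `Aⁿ` in `H_A` as the sequences supported on the first `n` places. -/
def initial : (Fin n → A) →ₗ[A] StandardModule A :=
  LinearMap.codRestrict (squareSummable A)
    { toFun a k := if hk : k < n then a ⟨k, hk⟩ else 0
      map_add' a b := by ext k; by_cases hk : k < n <;> simp [hk]
      map_smul' a b := by ext k; by_cases hk : k < n <;> simp [hk] }
    fun a => (summable_nat_add_iff n).1 (by simp [summable_zero])

theorem initial_apply (a : Fin n → A) (k : ℕ) :
    (initial n a).1 k = if hk : k < n then a ⟨k, hk⟩ else 0 := rfl

theorem initial_add_shift_backwardShift (x : StandardModule A) :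
    initial n (fun k => x.1 k) + shift n (backwardShift n x) = x := by
  ext k
  by_cases hk : k < n
  · simp [initial_apply, shift_apply, hk]
  · simp [initial_apply, shift_apply, backwardShift_apply, hk, Nat.sub_add_cancel (not_lt.1 hk)]

theorem cofg_range_shift : (shift n : StandardModule A →ₗ[A] StandardModule A).range.CoFG := by
  have hfg : (initial n : (Fin n → A) →ₗ[A] StandardModule A).range.FG :=
    Module.Finite.iff_fg.1 inferInstance
  refine hfg.cofg_of_codisjoint (codisjoint_iff.2 (Submodule.eq_top_iff'.2 fun x => ?_))
  rw [← initial_add_shift_backwardShift n x]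
  exact Submodule.add_mem_sup ⟨_, rfl⟩ ⟨_, rfl⟩

end Shift

end StandardModule

/-! ### Semi-Fredholm operators -/

section SemiFredholm

open StandardModule

variable {A : Type*} [CStarAlgebra A] {F : StandardModule A →L[A] StandardModule A}
  {M₁ N₁ M₂ N₂ : Submodule A (StandardModule A)}

theorem IsDiagonalDecomposition.exists_norm_le (h : IsDiagonalDecomposition F M₁ N₁ M₂ N₂) :
    ∃ C, 0 ≤ C ∧ ∀ p ∈ M₁, ∀ q ∈ N₁, ‖p‖ ≤ C * ‖F (p + q)‖ := by
  obtain ⟨C, hC, hproj⟩ :=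
    exists_norm_le_of_isCompl ℂ h.isCompl_range h.isClosed_M₂ h.isClosed_N₂
  obtain ⟨F₁, hF₁⟩ := h.iso
  let B : M₂ →L[ℂ] M₁ := (F₁.symm : M₂ →L[A] M₁).restrictScalars ℂ
  refine ⟨‖B‖ * C, by positivity, fun p hp q hq => ?_⟩
  have hFp : F p = F₁ ⟨p, hp⟩ := hF₁ ⟨p, hp⟩
  calc ‖p‖ = ‖B (F₁ ⟨p, hp⟩)‖ := congrArg (fun z : M₁ => ‖z‖) (F₁.symm_apply_apply ⟨p, hp⟩).symm
    _ ≤ ‖B‖ * ‖F₁ ⟨p, hp⟩‖ := B.le_opNorm _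
    _ ≤ ‖B‖ * (C * ‖F (p + q)‖) := by
        gcongr
        rw [map_add, hFp]
        exact hproj _ (F₁ ⟨p, hp⟩).2 _ (h.map_N q hq)
    _ = ‖B‖ * C * ‖F (p + q)‖ := (mul_assoc _ _ _).symm

theorem IsDiagonalDecomposition.exists_norm_le_add_sum (h : IsDiagonalDecomposition F M₁ N₁ M₂ N₂)
    (hN₁ : N₁.FG) :
    ∃ (r : ℕ) (u : Fin r → StandardModule A) (C : ℝ), 0 < C ∧
      ∀ y, ‖y‖ ≤ C * (‖F y‖ + ∑ i, ‖⟪y, u i⟫_A‖) := by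
  let _ : PartialOrder A := CStarAlgebra.spectralOrder A
  have _ : StarOrderedRing A := CStarAlgebra.spectralOrderedRing A
  obtain ⟨r, u, hu⟩ := Submodule.fg_iff_exists_fin_generating_family.1 hN₁
  obtain ⟨K, hK, hM⟩ := h.exists_norm_le
  obtain ⟨C, hC, hN⟩ := exists_norm_add_le_norm_add_sum_norm_inner u (hu ▸ h.isClosed_N₁)
  refine ⟨r, u, C * (K + 1), by positivity, fun y => ?_⟩
  obtain ⟨p, q, hp, hq, rfl⟩ :=
    Submodule.codisjoint_iff_exists_add_eq.1 h.isCompl_domain.codisjoint y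
  calc ‖p + q‖ ≤ C * (‖p‖ + ∑ i, ‖⟪p + q, u i⟫_A‖) := hN p q (hu ▸ hq)
    _ ≤ C * (K * ‖F (p + q)‖ + ∑ i, ‖⟪p + q, u i⟫_A‖) := by gcongr; exact hM p hp q hq
    _ ≤ C * (K + 1) * (‖F (p + q)‖ + ∑ i, ‖⟪p + q, u i⟫_A‖) := by
        have : 0 ≤ C * (K * ∑ i, ‖⟪p + q, u i⟫_A‖ + ‖F (p + q)‖) := by positivity
        linarith

theorem exists_le_norm_comp_shift (hF : F ∈ upperSemiFredholm A) :
    ∃ n, ∃ c > 0, ∀ x, c * ‖x‖ ≤ ‖F (shift n x)‖ := by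
  let _ : PartialOrder A := CStarAlgebra.spectralOrder A
  have _ : StarOrderedRing A := CStarAlgebra.spectralOrderedRing A
  obtain ⟨-, M₁, N₁, M₂, N₂, h, hN₁⟩ := hF
  obtain ⟨r, u, C, hC, hbound⟩ := h.exists_norm_le_add_sum hN₁
  have hlim : Tendsto (fun n => C * ∑ i, ‖backwardShift n (u i)‖) atTop (𝓝 0) := by
    simpa using (tendsto_finsetSum Finset.univ fun i _ =>
      tendsto_norm_backwardShift (u i)).const_mul C
  obtain ⟨n, hn⟩ := (hlim.eventually_lt_const one_half_pos).exists
  refine ⟨n, (2 * C)⁻¹, by positivity, fun x => ?_⟩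
  have hinner : ∑ i, ‖⟪shift n x, u i⟫_A‖ ≤ ‖x‖ * ∑ i, ‖backwardShift n (u i)‖ := by
    rw [Finset.mul_sum]
    gcongr with i
    rw [inner_shift_left]
    exact CStarModule.norm_inner_le (StandardModule A)
  have habsorb : ‖x‖ ≤ C * ‖F (shift n x)‖ + ‖x‖ * (1 / 2) := by
    calc ‖x‖ ≤ C * (‖F (shift n x)‖ + ∑ i, ‖⟪shift n x, u i⟫_A‖) := by
          simpa only [norm_shift] using hbound (shift n x)
      _ ≤ C * (‖F (shift n x)‖ + ‖x‖ * ∑ i, ‖backwardShift n (u i)‖) := by gcongr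
      _ = C * ‖F (shift n x)‖ + ‖x‖ * (C * ∑ i, ‖backwardShift n (u i)‖) := by ring
      _ ≤ C * ‖F (shift n x)‖ + ‖x‖ * (1 / 2) := by gcongr
  rw [inv_mul_le_iff₀ (by positivity)]
  linarith

theorem isDiagonalDecomposition_of_leftInverse {J L : StandardModule A →L[A] StandardModule A}
    (h : Function.LeftInverse L (F ∘L J)) :
    IsDiagonalDecomposition F J.range (L ∘L F).ker (F ∘L J).range L.ker where
  isClosed_M₁ := (ContinuousLinearMap.isTopCompl_range_ker_of_leftInverse J (L ∘L F) h).isClosed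
  isClosed_N₁ := (ContinuousLinearMap.isTopCompl_range_ker_of_leftInverse J (L ∘L F) h).isClosed'
  isClosed_M₂ := (ContinuousLinearMap.isTopCompl_range_ker_of_leftInverse (F ∘L J) L h).isClosed
  isClosed_N₂ := (ContinuousLinearMap.isTopCompl_range_ker_of_leftInverse (F ∘L J) L h).isClosed'
  isCompl_domain := (ContinuousLinearMap.isTopCompl_range_ker_of_leftInverse J (L ∘L F) h).isCompl
  isCompl_range := (ContinuousLinearMap.isTopCompl_range_ker_of_leftInverse (F ∘L J) L h).isCompl
  iso := by
    let f : J.range →L[A] (F ∘L J).range :=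
      (F ∘L J.range.subtypeL).codRestrict _ (by rintro ⟨_, x, rfl⟩; exact ⟨x, rfl⟩)
    let g : (F ∘L J).range →L[A] J.range :=
      (J ∘L L ∘L (F ∘L J).range.subtypeL).codRestrict _ fun y => ⟨L y, rfl⟩
    have hgf : Function.LeftInverse g f := by
      rintro ⟨_, x, rfl⟩
      exact Subtype.ext (congrArg J (h x))
    have hfg : Function.RightInverse g f := by
      rintro ⟨_, x, rfl⟩
      exact Subtype.ext (congrArg (F ∘L J) (h x))
    exact ⟨.equivOfInverse f g hgf hfg, fun _ => rfl⟩
  map_N _ hx := hx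

theorem IsDiagonalDecomposition.cofg_range (h : IsDiagonalDecomposition F M₁ N₁ M₂ N₂)
    (hN₂ : N₂.FG) : F.range.CoFG := by
  obtain ⟨F₁, hF₁⟩ := h.iso
  have hM₂ : M₂ ≤ F.range := fun y hy =>
    ⟨F₁.symm ⟨y, hy⟩, (hF₁ _).trans (by rw [F₁.apply_symm_apply])⟩
  exact hN₂.cofg_of_codisjoint (h.isCompl_range.symm.codisjoint.mono_right hM₂)

theorem mem_fredholm_of_mem_upperSemiFredholm (hF : F ∈ upperSemiFredholm A)
    (hrange : F.range.CoFG) : F ∈ fredholm A := by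
  let _ : PartialOrder A := CStarAlgebra.spectralOrder A
  have _ : StarOrderedRing A := CStarAlgebra.spectralOrderedRing A
  obtain ⟨n, c, hc, hbelow⟩ := exists_le_norm_comp_shift hF
  obtain ⟨G, hFG⟩ := hF.1
  have hadj (x y : StandardModule A) :
      ⟪(F ∘L shiftL n) x, y⟫_A = ⟪x, (backwardShiftL n ∘L G) y⟫_A :=
    (hFG _ y).trans (inner_shift_left n x _)
  obtain ⟨L, hL⟩ := exists_leftInverse_of_adjoint hadj hc hbelow
  have h := isDiagonalDecomposition_of_leftInverse hL
  have hshift : (shiftL n : StandardModule A →L[A] StandardModule A).range.CoFG :=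
    cofg_range_shift n
  exact ⟨hF.1, _, _, _, _, h, hshift.fg_of_isCompl h.isCompl_domain,
    (cofg_range_comp hrange hshift).fg_of_isCompl h.isCompl_range⟩

end SemiFredholm

end HilbertCStar

end

theorem corollary2p4 (A : Type*) [CStarAlgebra A] :
    HilbertCStar.fredholm A =
      HilbertCStar.upperSemiFredholm A ∩ HilbertCStar.lowerSemiFredholm A := by
  refine Set.Subset.antisymm ?_ ?_
  · rintro F ⟨hF, M₁, N₁, M₂, N₂, h, hN₁, hN₂⟩
    exact ⟨⟨hF, M₁, N₁, M₂, N₂, h, hN₁⟩, ⟨hF, M₁, N₁, M₂, N₂, h, hN₂⟩⟩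
  · rintro F ⟨hupper, -, M₁, N₁, M₂, N₂, h, hN₂⟩
    exact HilbertCStar.mem_fredholm_of_mem_upperSemiFredholm hupper (h.cofg_range hN₂)
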